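/- Let $D$ be an integral domain with quotient field $K$. Let $\overline{F}(D)$ be the set of nonzero $D$-submodules of $K$ and $f(D)\subseteq\overline F(D)$ the set of nonzero finitely generated ones. A semistar operation of $D$ is a map $\star:\overline F(D)\to\overline F(D)$, $E\mapsto E^\star$, such that for all $0\ne z\in K$ and $E,F\in\overline F(D)$: $(zE)^\star=zE^\star$; $E\subseteq F$ implies $E^\star\subseteq F^\star$; $E\subseteq E^\star$ and $(E^\star)^\star=E^\star$. It is eab if, for all $F,G,H\in f(D)$, $(FG)^\star\subseteq(FH)^\star$ implies $G^\star\subseteq H^\star$. Two semistar operations are equivalent if they agree on $f(D)$. For a semistar operation $\star$ and $E\in\overline F(D)$ define: (a) $E^{\star_f}=\bigcup\{F^\star\mid F\in f(D),\ F\subseteq E\}$; the operation $\star$ is of finite type if $\star=\star_f$. (b) $E^{\circlearrowleft_{\mathrm{Kr}}}=E\,\mathrm{Kr}(D,\star)\cap K$, where $\mathrm{Kr}(D,\star)\subseteq K(X)$ is the set of all $f/g$ with $f,g\in D[X]$, $g\neq0$, such that $f=0$ or there is $h\in D[X]\setminus\{0\}$ with $(c(f)c(h))^\star\subseteq(c(g)c(h))^\star$;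 here $c(\cdot)$ is the content, i.e. the ideal of $D$ generated by the coefficients, and $E\,\mathrm{Kr}(D,\star)$ is the set of finite sums of products of an element of $E$ and an element of $\mathrm{Kr}(D,\star)$. (c) $E^{b(\star)}=\bigcap_V EV$, where $V$ ranges over the valuation overrings of $D$ (valuation rings $V$ with $D\subseteq V\subseteq K$, including $V=K$) such that $F^\star\subseteq FV$ for all $F\in f(D)$. (d) $F^{\star_a}=\bigcup\{((FH)^\star:H^\star)\mid H\in f(D)\}$ for $F\in f(D)$, where $(A:B)=\{x\in K\mid xB\subseteq A\}$, and $E^{\star_a}=\bigcup\{F^{\star_a}\mid F\in f(D),\ F\subseteq E\}$ for $E\in\overline F(D)$. Let $\star$ be an eab semistar operation of $D$. Then $$\star_f={\circlearrowleft_{\mathrm{Kr}}}=b(\star)=\star_a .$$ Consequently there is exactly one eab semistar operation of finite type that is equivalent to $\star$, and every semistar operation of finite type equivalent to $\star$ is equal to $\star_f={\circlearrowleft_{\mathrm{Kr}}}=b(\star)=\star_a$. -/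

import Mathlib

open scoped Polynomial

/-- The nonzero `D`-submodules of the quotient field `K` of `D`. -/
abbrev NonzeroSubmodule (D K : Type*) [CommRing D] [Field K] [Algebra D K] : Type _ :=
  {E : Submodule D K // E ≠ ⊥}

namespace NonzeroSubmodule

variable {D K : Type*} [CommRing D] [Field K] [Algebra D K]

/-- The product of two nonzero submodules of `K` (finite sums of products `x * y`). -/
instance : Mul (NonzeroSubmodule D K) :=
  ⟨fun E F => ⟨E.1 * F.1, fun h => by
    obtain ⟨x, hx, hx0⟩ := (Submodule.ne_bot_iff _).1 E.2
    obtain ⟨y, hy, hy0⟩ := (Submodule.ne_bot_iff _).1 F.2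
    have hxy : x * y ∈ E.1 * F.1 := Submodule.mul_mem_mul hx hy
    rw [h, Submodule.mem_bot] at hxy
    exact mul_ne_zero hx0 hy0 hxy⟩⟩

theorem coe_mul (E F : NonzeroSubmodule D K) : (E * F).1 = E.1 * F.1 := rfl

/-- The nonzero submodule `z E = {z * x | x ∈ E}`, for `z ≠ 0` in `K`. -/
def scale (z : K) (hz : z ≠ 0) (E : NonzeroSubmodule D K) : NonzeroSubmodule D K :=
  ⟨E.1.map (LinearMap.mulLeft D z), fun h => by
    obtain ⟨x, hx, hx0⟩ := (Submodule.ne_bot_iff _).1 E.2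
    have hzx : z * x ∈ E.1.map (LinearMap.mulLeft D z) := ⟨x, hx, rfl⟩
    rw [h, Submodule.mem_bot] at hzx
    exact mul_ne_zero hz hx0 hzx⟩

/-- `E` is a (nonzero) finitely generated fractional ideal of `D`. -/
def IsFG (E : NonzeroSubmodule D K) : Prop := E.1.FG

theorem IsFG.mul {E F : NonzeroSubmodule D K} (hE : E.IsFG) (hF : F.IsFG) : (E * F).IsFG :=
  Submodule.FG.mul hE hF

theorem mul_le_mul {E E' F F' : NonzeroSubmodule D K} (h : E ≤ E') (h' : F ≤ F') :
    E * F ≤ E' * F' :=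
  Submodule.mul_le.2 fun _ hx _ hy => Submodule.mul_mem_mul (h hx) (h' hy)

/-- The principal fractional ideal `D x`, for `x ≠ 0`. -/
def principal (D : Type*) {K : Type*} [CommRing D] [Field K] [Algebra D K] (x : K) (hx : x ≠ 0) :
    NonzeroSubmodule D K :=
  ⟨Submodule.span D {x}, by simpa using hx⟩

theorem principal_isFG (x : K) (hx : x ≠ 0) : (principal D x hx).IsFG :=
  Submodule.fg_span_singleton x

/-- The sum of two nonzero submodules. -/
def sum (E F : NonzeroSubmodule D K) : NonzeroSubmodule D K :=
  ⟨E.1 ⊔ F.1, fun h => E.2 (eq_bot_iff.2 (le_sup_left.trans h.le))⟩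

theorem le_sum_left (E F : NonzeroSubmodule D K) : E ≤ E.sum F :=
  (le_sup_left : E.1 ≤ E.1 ⊔ F.1)

theorem le_sum_right (E F : NonzeroSubmodule D K) : F ≤ E.sum F :=
  (le_sup_right : F.1 ≤ E.1 ⊔ F.1)

theorem sum_le {E F G : NonzeroSubmodule D K} (h : E ≤ G) (h' : F ≤ G) : E.sum F ≤ G :=
  (sup_le (show E.1 ≤ G.1 from h) (show F.1 ≤ G.1 from h') : E.1 ⊔ F.1 ≤ G.1)

theorem IsFG.sum {E F : NonzeroSubmodule D K} (hE : E.IsFG) (hF : F.IsFG) : (E.sum F).IsFG :=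
  Submodule.FG.sup hE hF

/-- Every nonzero submodule contains a nonzero finitely generated one. -/
theorem exists_isFG_le (E : NonzeroSubmodule D K) : ∃ F : NonzeroSubmodule D K, F.IsFG ∧ F ≤ E := by
  obtain ⟨x, hx, hx0⟩ := (Submodule.ne_bot_iff _).1 E.2
  refine ⟨principal D x hx0, principal_isFG x hx0, ?_⟩
  change Submodule.span D {x} ≤ E.1
  rwa [Submodule.span_singleton_le_iff_mem]

end NonzeroSubmodule

open NonzeroSubmodule

/-- A semistar operation of `D` (with quotient field `K`). -/
structure SemistarOperation (D K : Type*) [CommRing D] [Field K] [Algebra D K] where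
  toFun : NonzeroSubmodule D K → NonzeroSubmodule D K
  map_scale' : ∀ (z : K) (hz : z ≠ 0) (E : NonzeroSubmodule D K),
    toFun (scale z hz E) = scale z hz (toFun E)
  mono' : ∀ E F : NonzeroSubmodule D K, E ≤ F → toFun E ≤ toFun F
  le_map' : ∀ E : NonzeroSubmodule D K, E ≤ toFun E
  idem' : ∀ E : NonzeroSubmodule D K, toFun (toFun E) = toFun E

namespace SemistarOperation

variable {D K : Type*} [CommRing D] [Field K] [Algebra D K]

instance : CoeFun (SemistarOperation D K)
    (fun _ => NonzeroSubmodule D K → NonzeroSubmodule D K) := ⟨toFun⟩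

/-- `F` is `⋆`-eab: `(FG)^⋆ ⊆ (FH)^⋆` implies `G^⋆ ⊆ H^⋆`, for all nonzero finitely generated
fractional ideals `G`, `H`. -/
def IsEABAt (s : SemistarOperation D K) (F : NonzeroSubmodule D K) : Prop :=
  ∀ G H : NonzeroSubmodule D K, G.IsFG → H.IsFG → s (F * G) ≤ s (F * H) → s G ≤ s H

/-- `⋆` is an eab semistar operation. -/
def IsEAB (s : SemistarOperation D K) : Prop :=
  ∀ F : NonzeroSubmodule D K, F.IsFG → s.IsEABAt F

/-- Two semistar operations are equivalent if they agree on all nonzero finitely generated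
fractional ideals. -/
def IsEquivalent (s t : SemistarOperation D K) : Prop :=
  ∀ F : NonzeroSubmodule D K, F.IsFG → s F = t F

/-- The map `⋆_f`: `E ↦ ⋃ {F^⋆ | F ⊆ E, F nonzero finitely generated}`. -/
def finiteTypeMap (s : SemistarOperation D K) (E : NonzeroSubmodule D K) :
    NonzeroSubmodule D K :=
  ⟨{ carrier := {x | ∃ F : NonzeroSubmodule D K, F.IsFG ∧ F ≤ E ∧ x ∈ (s F).1}
     zero_mem' := by
       obtain ⟨F, hF, hFE⟩ := E.exists_isFG_le
       exact ⟨F, hF, hFE, zero_mem _⟩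
     add_mem' := by
       rintro x y ⟨F, hF, hFE, hx⟩ ⟨G, hG, hGE, hy⟩
       exact ⟨F.sum G, hF.sum hG, sum_le hFE hGE,
         add_mem (s.mono' _ _ (le_sum_left F G) hx) (s.mono' _ _ (le_sum_right F G) hy)⟩
     smul_mem' := by
       rintro d x ⟨F, hF, hFE, hx⟩
       exact ⟨F, hF, hFE, Submodule.smul_mem _ d hx⟩ },
   fun h => by
     obtain ⟨F, hF, hFE⟩ := E.exists_isFG_le
     obtain ⟨x, hx, hx0⟩ := (Submodule.ne_bot_iff _).1 F.2
     have hx' := (Submodule.eq_bot_iff _).1 h x ⟨F, hF, hFE, s.le_map' F hx⟩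
     exact hx0 hx'⟩

/-- `⋆` is of finite type: `⋆ = ⋆_f`. -/
def IsFiniteType (s : SemistarOperation D K) : Prop := s.toFun = s.finiteTypeMap

/-- A valuation overring `V` of `D` (inside `K`) is a `⋆`-valuation overring if `F^⋆ ⊆ F V` for
every nonzero finitely generated fractional ideal `F`. The ring `K` itself is allowed. -/
def IsValuationOverring (s : SemistarOperation D K) (V : Subalgebra D K) : Prop :=
  ValuationRing V ∧
    ∀ F : NonzeroSubmodule D K, F.IsFG → (s F).1 ≤ F.1 * Subalgebra.toSubmodule V

/-- The map `b(⋆)`: `E ↦ ⋂ {E V | V a ⋆-valuation overring of D}`. -/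
def bMap (s : SemistarOperation D K) (E : NonzeroSubmodule D K) : NonzeroSubmodule D K :=
  ⟨⨅ (V : Subalgebra D K) (_ : s.IsValuationOverring V), E.1 * Subalgebra.toSubmodule V,
   fun h => by
     refine E.2 (eq_bot_iff.2 (le_trans (le_iInf₂ fun V _ x hx => ?_) h.le))
     simpa using Submodule.mul_mem_mul hx (show (1 : K) ∈ Subalgebra.toSubmodule V from V.one_mem)⟩

/-- For a nonzero finitely generated `F`, the set `F^{⋆_a} = ⋃ ((F H)^⋆ : H^⋆)`, the union being
over all nonzero finitely generated `H`. The quotient `A / B` of submodules of `K` is the colon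
`(A : B) = {x ∈ K | x B ⊆ A}`. -/
def aSet (s : SemistarOperation D K) (F : NonzeroSubmodule D K) : Set K :=
  {x | ∃ H : NonzeroSubmodule D K, H.IsFG ∧ x ∈ (s (F * H)).1 / (s H).1}

theorem mem_div_iff (s : SemistarOperation D K) {F H : NonzeroSubmodule D K} {x : K} :
    x ∈ (s F).1 / (s H).1 ↔ ∀ y ∈ H.1, x * y ∈ (s F).1 := by
  rw [Submodule.mem_div_iff_forall_mul_mem]
  refine ⟨fun h y hy => h y (s.le_map' H hy), fun h y hy => ?_⟩
  by_cases hx : x = 0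
  · simp [hx]
  have h1 : scale x hx H ≤ s F := by
    rintro _ ⟨z, hz, rfl⟩
    exact h z hz
  have h2 := s.mono' _ _ h1
  rw [s.idem', s.map_scale'] at h2
  exact h2 ⟨y, hy, rfl⟩

theorem aSet_subset_mul (s : SemistarOperation D K) {F F' H H' : NonzeroSubmodule D K} {x : K}
    (hF : F ≤ F') (hx : x ∈ (s (F * H)).1 / (s H).1) :
    x ∈ (s (F' * (H * H'))).1 / (s (H * H')).1 := by
  rw [mem_div_iff] at hx ⊢
  intro y hy
  rw [coe_mul] at hy
  induction hy using Submodule.mul_induction_on' with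
  | mem_mul_mem a ha c hc =>
    by_cases hc0 : c = 0
    · simp [hc0]
    have h1 : scale c hc0 (F * H) ≤ F' * (H * H') := by
      rintro _ ⟨z, hz, rfl⟩
      have h3 : z * c ∈ (F.1 * H.1) * H'.1 := Submodule.mul_mem_mul hz hc
      rw [mul_assoc] at h3
      have h4 := NonzeroSubmodule.mul_le_mul (F := H * H') (F' := H * H') hF le_rfl h3
      simpa [mul_comm, coe_mul] using h4
    have h2 := s.mono' _ _ h1
    rw [s.map_scale'] at h2
    have h5 := h2 ⟨x * a, hx a ha, rfl⟩
    have h6 : LinearMap.mulLeft D c (x * a) = x * (a * c) := by simp; ring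
    rwa [h6] at h5
  | add a _ b _ iha ihb =>
    rw [mul_add]
    exact add_mem iha ihb

/-- The map `⋆_a`: `E ↦ ⋃ {F^{⋆_a} | F ⊆ E, F nonzero finitely generated}`. -/
def aMap (s : SemistarOperation D K) (E : NonzeroSubmodule D K) : NonzeroSubmodule D K :=
  ⟨{ carrier := {x | ∃ F : NonzeroSubmodule D K, F.IsFG ∧ F ≤ E ∧ x ∈ s.aSet F}
     zero_mem' := by
       obtain ⟨F, hF, hFE⟩ := E.exists_isFG_le
       exact ⟨F, hF, hFE, F, hF, zero_mem _⟩
     add_mem' := by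
       rintro x y ⟨F, hF, hFE, H, hH, hx⟩ ⟨F', hF', hFE', H', hH', hy⟩
       refine ⟨F.sum F', hF.sum hF', sum_le hFE hFE', H * H', hH.mul hH', ?_⟩
       have h1 := s.aSet_subset_mul (H' := H') (le_sum_left F F') hx
       have h2 := s.aSet_subset_mul (H' := H) (le_sum_right F F') hy
       have h3 : H' * H = H * H' := Subtype.ext (mul_comm H'.1 H.1)
       rw [h3] at h2
       exact add_mem h1 h2
     smul_mem' := by
       rintro d x ⟨F, hF, hFE, H, hH, hx⟩
       exact ⟨F, hF, hFE, H, hH, Submodule.smul_mem _ d hx⟩ },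
   fun h => by
     obtain ⟨F, hF, hFE⟩ := E.exists_isFG_le
     obtain ⟨x, hx, hx0⟩ := (Submodule.ne_bot_iff _).1 F.2
     refine hx0 ((Submodule.eq_bot_iff _).1 h x ⟨F, hF, hFE, F, hF, ?_⟩)
     rw [mem_div_iff]
     exact fun y hy => s.le_map' _ (Submodule.mul_mem_mul hx hy)⟩

/-- On finitely generated `F` the two clauses defining `⋆_a` agree. -/
theorem coe_aMap_of_isFG (s : SemistarOperation D K) {F : NonzeroSubmodule D K} (hF : F.IsFG) :
    ((s.aMap F).1 : Set K) = s.aSet F := by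
  ext x
  refine ⟨?_, fun hx => ⟨F, hF, le_rfl, hx⟩⟩
  rintro ⟨G, -, hGF, H, hH, hx⟩
  exact ⟨H * H, hH.mul hH, s.aSet_subset_mul hGF hx⟩

section Kronecker

variable [IsDomain D] [IsFractionRing D K]

/-- The content of a nonzero polynomial over `D`: the ideal generated by its coefficients, viewed
inside `K`. -/
def contentSubmodule (K : Type*) [Field K] [Algebra D K] [IsFractionRing D K]
    (f : D[X]) (hf : f ≠ 0) : NonzeroSubmodule D K :=
  ⟨Submodule.span D (Set.range fun n : ℕ => algebraMap D K (f.coeff n)), fun h => by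
    refine hf (Polynomial.ext fun n => ?_)
    have h1 := Submodule.span_eq_bot.1 h _ ⟨n, rfl⟩
    simpa using h1⟩

/-- A polynomial over `D` regarded as an element of `K(X)`. -/
noncomputable def toRatFunc (K : Type*) [Field K] [Algebra D K] (f : D[X]) : RatFunc K :=
  algebraMap K[X] (RatFunc K) (f.map (algebraMap D K))

/-- The semistar Kronecker function ring `Kr(D, ⋆)`, as a subset of `K(X)`: the fractions `f / g`
with `f, g ∈ D[X]`, `g ≠ 0`, such that `(c(f) c(h))^⋆ ⊆ (c(g) c(h))^⋆` for some nonzero `h ∈ D[X]`.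
For `f = 0` the condition is understood to hold, so that `0` belongs to `Kr(D, ⋆)`. -/
def kroneckerSet (s : SemistarOperation D K) : Set (RatFunc K) :=
  {x | ∃ f g : D[X], ∃ hg : g ≠ 0, x = toRatFunc K f / toRatFunc K g ∧
    ∀ hf : f ≠ 0, ∃ h : D[X], ∃ hh : h ≠ 0,
      s (contentSubmodule K f hf * contentSubmodule K h hh) ≤
        s (contentSubmodule K g hg * contentSubmodule K h hh)}

/-- `E Kr(D, ⋆)`: the finite sums of products `e * k` with `e ∈ E`, `k ∈ Kr(D, ⋆)`. -/
noncomputable def kroneckerExtension (s : SemistarOperation D K) (E : NonzeroSubmodule D K) :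
    Submodule D (RatFunc K) :=
  Submodule.span D {x | ∃ e ∈ E.1, ∃ k ∈ s.kroneckerSet, x = algebraMap K (RatFunc K) e * k}

/-- The map `E ↦ E Kr(D, ⋆) ∩ K`. -/
noncomputable def krMap (s : SemistarOperation D K) (E : NonzeroSubmodule D K) :
    NonzeroSubmodule D K :=
  ⟨(s.kroneckerExtension E).comap (IsScalarTower.toAlgHom D K (RatFunc K)).toLinearMap,
   fun h => by
     refine E.2 (eq_bot_iff.2 fun x hx => h.le ?_)
     refine Submodule.subset_span ⟨x, hx, 1, ?_, ?_⟩
     · refine ⟨1, 1, one_ne_zero, by simp [toRatFunc], fun _ => ⟨1, one_ne_zero, le_rfl⟩⟩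
     · simp⟩

end Kronecker

end SemistarOperation

/-!
The four maps are compared in a circle, `⋆_f ≤ Kr ≤ b(⋆) ≤ ⋆_f`, and `⋆_a = ⋆_f` is the cancellation
property applied to `x H ⊆ (F H)^⋆` (`finiteTypeMap_eq_aMap`).

* `⋆_f ≤ Kr` (`finiteTypeMap_le_krMap`): if `x ∈ (a₀, …, aₙ)^⋆`, then
  `x = ∑ aᵢ * (x Xⁱ / ∑ aⱼ Xʲ)` exhibits `x` as an element of `E Kr(D, ⋆)`.
* `Kr ≤ b(⋆)` (`krMap_le_bMap`): for a `⋆`-valuation overring `V`, contents become principal over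
  `V`, so every element of `E Kr(D, ⋆)` is a fraction with numerator in `(E V)[X]` and denominator in
  `V[X]` having a unit coefficient. Primitivity of denominators is preserved under products because
  the residue field of `V` gives a polynomial ring without zero divisors. Comparing coefficients at a
  unit coefficient of the denominator shows that constants of this form lie in `E V`.
* `b(⋆) ≤ ⋆_f` (`bMap_le_finiteTypeMap`): the relation `F ⊆ G^⋆` on nonzero finitely generated
  submodules is a preorder for which multiplication is monotone and, as `⋆` is eab, cancellative.
  If `x ∉ E^{⋆_f}`, Zorn's lemma extends it to a maximal such preorder under which `D x` is below no
  finitely generated submodule of `E`. Maximality forces totality (`exists_total_extension`): this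
  is the argument that a Bézout domain localized at a maximal ideal is a valuation domain, carried
  out on contents without forming the Kronecker function ring. The elements `y` with `D y` below `D`
  then form a `⋆`-valuation overring `V` with `x ∉ E V`.

The map `⋆_f` depends only on the restriction of `⋆` to finitely generated submodules, and it is
itself a semistar operation of finite type equivalent to `⋆`; this gives existence and uniqueness.
-/

/-! ### Total extensions of cancellative preorders -/

/-- A preorder `r` on a commutative monoid with suprema, coarser than the given order, for which
suprema are still least upper bounds and multiplication is both monotone and cancellative. -/
structure IsCancelPreorder {M : Type*} [CommMonoid M] [SemilatticeSup M] (r : M → M → Prop) :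
    Prop where
  of_le : ∀ {a b}, a ≤ b → r a b
  trans : ∀ {a b c}, r a b → r b c → r a c
  sup : ∀ {a b c}, r a c → r b c → r (a ⊔ b) c
  mul_right : ∀ {a b} c, r a b → r (a * c) (b * c)
  cancel : ∀ {a b} c, r (a * c) (b * c) → r a b

namespace IsCancelPreorder

variable {M : Type*} [CommMonoid M] {r : M → M → Prop}

/-- `r` with the relation `c ≤ a` adjoined: the analogue of inverting the fraction `a / c`. -/
def adjoin (r : M → M → Prop) (a c : M) (x y : M) : Prop :=
  ∃ n : ℕ, r (x * a ^ n) (y * c ^ n)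

theorem le_adjoin {a c x y : M} (h : r x y) : adjoin r a c x y :=
  ⟨0, by simpa using h⟩

variable [SemilatticeSup M]

theorem mul_left (hr : IsCancelPreorder r) {a b : M} (c : M) (h : r a b) : r (c * a) (c * b) := by
  simpa [mul_comm c] using hr.mul_right c h

theorem mul (hr : IsCancelPreorder r) {a b c d : M} (h : r a b) (h' : r c d) :
    r (a * c) (b * d) :=
  hr.trans (hr.mul_right c h) (hr.mul_left b h')

theorem pow (hr : IsCancelPreorder r) {a b : M} (h : r a b) (n : ℕ) : r (a ^ n) (b ^ n) := by
  induction n with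
  | zero => simpa using hr.of_le le_rfl
  | succ n ih => rw [pow_succ, pow_succ]; exact hr.mul ih h

theorem adjoin_rel (hr : IsCancelPreorder r) (a c : M) : adjoin r a c c a :=
  ⟨1, hr.of_le (by rw [pow_one, pow_one, mul_comm])⟩

theorem adjoin_lift (hr : IsCancelPreorder r) {a c x y : M} (hac : r a c) {n m : ℕ} (hnm : n ≤ m)
    (h : r (x * a ^ n) (y * c ^ n)) : r (x * a ^ m) (y * c ^ m) := by
  obtain ⟨k, rfl⟩ := Nat.exists_eq_add_of_le hnm
  rw [pow_add, pow_add, ← mul_assoc, ← mul_assoc]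
  exact hr.mul h (hr.pow hac k)

theorem isCancelPreorder_adjoin (hd : ∀ a b c : M, (a ⊔ b) * c = a * c ⊔ b * c)
    (hr : IsCancelPreorder r) {a c : M} (hac : r a c) : IsCancelPreorder (adjoin r a c) where
  of_le h := le_adjoin (hr.of_le h)
  trans := by
    rintro x y z ⟨n, hn⟩ ⟨m, hm⟩
    refine ⟨n + m, ?_⟩
    have h1 := hr.mul_right (a ^ m) hn
    have h2 := hr.mul_right (c ^ n) hm
    rw [mul_right_comm] at h2
    have h3 := hr.trans h1 h2
    rwa [mul_assoc, mul_assoc, ← pow_add, ← pow_add, add_comm m n] at h3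
  sup := by
    rintro x y z ⟨n, hn⟩ ⟨m, hm⟩
    refine ⟨max n m, ?_⟩
    rw [hd]
    exact hr.sup (hr.adjoin_lift hac (le_max_left n m) hn)
      (hr.adjoin_lift hac (le_max_right n m) hm)
  mul_right := by
    rintro x y z ⟨n, hn⟩
    refine ⟨n, ?_⟩
    rw [mul_right_comm, mul_right_comm y]
    exact hr.mul_right z hn
  cancel := by
    rintro x y z ⟨n, hn⟩
    refine ⟨n, hr.cancel z ?_⟩
    rwa [mul_right_comm, mul_right_comm y]

/-- Every monomial of degree `i + j` in `a` and `b` is divisible by `a ^ i` or by `b ^ j`. -/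
theorem sup_pow_add (hd : ∀ a b c : M, (a ⊔ b) * c = a * c ⊔ b * c) (hr : IsCancelPreorder r)
    (a b : M) (i j : ℕ) :
    r ((a ⊔ b) ^ (i + j)) (a ^ i * (a ⊔ b) ^ j ⊔ b ^ j * (a ⊔ b) ^ i) := by
  have ha : r a (a ⊔ b) := hr.of_le le_sup_left
  have hb : r b (a ⊔ b) := hr.of_le le_sup_right
  induction i generalizing j with
  | zero => exact hr.of_le (by simp)
  | succ i ihi =>
    induction j with
    | zero => exact hr.of_le (by simp)
    | succ j ihj =>
      set c := a ⊔ b with hc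
      set T := a ^ (i + 1) * c ^ (j + 1) ⊔ b ^ (j + 1) * c ^ (i + 1) with hT
      have e : c ^ (i + 1 + (j + 1)) = a * c ^ (i + (j + 1)) ⊔ b * c ^ (i + 1 + j) := by
        rw [show i + 1 + (j + 1) = (i + 1 + j) + 1 by ring, pow_succ', hc, hd,
          show i + 1 + j = i + (j + 1) by ring]
      have h1 : r (a ^ (i + 1) * c ^ (j + 1)) T := hr.of_le le_sup_left
      have h2 : r (b ^ (j + 1) * c ^ (i + 1)) T := hr.of_le le_sup_right
      rw [e]
      refine hr.sup (hr.trans (hr.mul_left a (ihi (j + 1))) ?_)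
        (hr.trans (hr.mul_left b ihj) ?_)
      · rw [mul_comm a, hd]
        refine hr.sup ?_ (hr.trans ?_ h2)
        · rwa [mul_right_comm, ← pow_succ]
        · rw [mul_assoc, pow_succ c i]
          exact hr.mul_left _ (hr.mul_left _ ha)
      · rw [mul_comm b, hd]
        refine hr.sup (hr.trans ?_ h1) ?_
        · rw [mul_assoc, pow_succ c j]
          exact hr.mul_left _ (hr.mul_left _ hb)
        · rwa [mul_right_comm, ← pow_succ]

/-- A cancellative preorder is the intersection of its total cancellative extensions, even when
separating an element from a whole directed set. A maximal extension is total: if neither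
`a ⊔ b ≤ a` nor `a ⊔ b ≤ b` could be adjoined, then `x * a ^ n` and `x * b ^ n` would both lie below
`y * (a ⊔ b) ^ n`, and cancelling would give `x ≤ y`. -/
theorem exists_total_extension (hd : ∀ a b c : M, (a ⊔ b) * c = a * c ⊔ b * c)
    {r₀ : M → M → Prop} (hr₀ : IsCancelPreorder r₀) (x : M) (S : Set M)
    (hS : ∀ a ∈ S, ∀ b ∈ S, a ⊔ b ∈ S) (hx : ∀ a ∈ S, ¬ r₀ x a) :
    ∃ r : M → M → Prop, IsCancelPreorder r ∧ (∀ a b, r₀ a b → r a b) ∧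
      (∀ a b, r a b ∨ r b a) ∧ ∀ a ∈ S, ¬ r x a := by
  obtain ⟨r, hle, hmax⟩ := zorn_le_nonempty₀
    {r : M → M → Prop | IsCancelPreorder r ∧ ∀ a ∈ S, ¬ r x a}
    (by
      intro C hC hchain r₁ hr₁
      refine ⟨fun a b => ∃ r ∈ C, r a b, ⟨?_, ?_⟩, fun r hr a b h => ⟨r, hr, h⟩⟩
      · have common : ∀ {a b c d}, (∃ r ∈ C, r a b) → (∃ r ∈ C, r c d) →
            ∃ r ∈ C, r a b ∧ r c d := by
          rintro a b c d ⟨r, hr, h⟩ ⟨r', hr', h'⟩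
          rcases hchain.total hr hr' with hle | hle
          · exact ⟨r', hr', hle _ _ h, h'⟩
          · exact ⟨r, hr, h, hle _ _ h'⟩
        exact
          { of_le := fun h => ⟨r₁, hr₁, (hC hr₁).1.of_le h⟩
            trans := fun h h' => by
              obtain ⟨r, hr, h1, h2⟩ := common h h'
              exact ⟨r, hr, (hC hr).1.trans h1 h2⟩
            sup := fun h h' => by
              obtain ⟨r, hr, h1, h2⟩ := common h h'
              exact ⟨r, hr, (hC hr).1.sup h1 h2⟩
            mul_right := fun c ⟨r, hr, h⟩ => ⟨r, hr, (hC hr).1.mul_right c h⟩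
            cancel := fun c ⟨r, hr, h⟩ => ⟨r, hr, (hC hr).1.cancel c h⟩ }
      · rintro a ha ⟨r, hr, h⟩
        exact (hC hr).2 a ha h)
    r₀ ⟨hr₀, hx⟩
  obtain ⟨hr, hxr⟩ := hmax.prop
  refine ⟨r, hr, fun a b h => hle a b h, ?_, hxr⟩
  have key : ∀ a c : M, r a c → r c a ∨ ∃ y ∈ S, ∃ n : ℕ, r (x * a ^ n) (y * c ^ n) := by
    intro a c hac
    by_contra! hcon
    refine hcon.1 ?_
    have hmem : adjoin r a c ∈ {r : M → M → Prop | IsCancelPreorder r ∧ ∀ a ∈ S, ¬ r x a} :=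
      ⟨isCancelPreorder_adjoin hd hr hac, fun y hy ⟨n, hn⟩ => hcon.2 y hy n hn⟩
    exact hmax.2 hmem (fun _ _ h => le_adjoin h) c a (adjoin_rel hr a c)
  intro a b
  have ha : r a (a ⊔ b) := hr.of_le le_sup_left
  have hb : r b (a ⊔ b) := hr.of_le le_sup_right
  rcases key a (a ⊔ b) ha with h | ⟨y, hy, n, hn⟩
  · exact Or.inr (hr.trans hb h)
  rcases key b (a ⊔ b) hb with h | ⟨z, hz, m, hm⟩
  · exact Or.inl (hr.trans ha h)
  exfalso
  set c := a ⊔ b with hc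
  set N := max n m
  have h1 : r (x * a ^ N) ((y ⊔ z) * c ^ N) :=
    hr.trans (hr.adjoin_lift ha (le_max_left n m) hn) (hr.mul_right _ (hr.of_le le_sup_left))
  have h2 : r (x * b ^ N) ((y ⊔ z) * c ^ N) :=
    hr.trans (hr.adjoin_lift hb (le_max_right n m) hm) (hr.mul_right _ (hr.of_le le_sup_right))
  -- `c ^ (2 N)` is equivalent to `(a ^ N ⊔ b ^ N) * c ^ N`, which combines the two bounds
  have h3 : r (x * c ^ (N + N)) ((y ⊔ z) * c ^ (N + N)) := by
    refine hr.trans (hr.mul_left x (hr.sup_pow_add hd a b N N)) ?_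
    rw [mul_comm x, hd, ← hc, mul_right_comm, mul_right_comm _ _ x, mul_comm _ x, mul_comm _ x,
      pow_add, ← mul_assoc (y ⊔ z)]
    exact hr.sup (hr.mul_right _ h1) (hr.mul_right _ h2)
  exact hxr _ (hS y hy z hz) (hr.cancel _ h3)

end IsCancelPreorder

/-! ### Nonzero finitely generated submodules -/

/-- The nonzero finitely generated `D`-submodules of `K`, as a multiplicative monoid. -/
def fgSubmonoid (D K : Type*) [CommRing D] [Field K] [Algebra D K] :
    Submonoid (Submodule D K) where
  carrier := {N | N ≠ ⊥ ∧ N.FG}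
  one_mem' := by
    rw [Submodule.one_eq_span]
    exact ⟨by simp, Submodule.fg_span_singleton 1⟩
  mul_mem' := by
    rintro E F ⟨hE, hE'⟩ ⟨hF, hF'⟩
    let E' : NonzeroSubmodule D K := ⟨E, hE⟩
    let F' : NonzeroSubmodule D K := ⟨F, hF⟩
    exact ⟨(E' * F').2, hE'.mul hF'⟩

namespace fgSubmonoid

variable {D K : Type*} [CommRing D] [Field K] [Algebra D K]

noncomputable instance : SemilatticeSup (fgSubmonoid D K) :=
  Subtype.semilatticeSup fun _ _ hx hy =>
    ⟨fun h => hx.1 (eq_bot_iff.2 (le_sup_left.trans h.le)), hx.2.sup hy.2⟩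

theorem coe_sup (a b : fgSubmonoid D K) :
    ((a ⊔ b : fgSubmonoid D K) : Submodule D K) = (a : Submodule D K) ⊔ b := rfl

theorem sup_mul (a b c : fgSubmonoid D K) : (a ⊔ b) * c = a * c ⊔ b * c :=
  Subtype.ext (Submodule.sup_mul _ _ _)

/-- A finitely generated submodule, as a term of the type on which semistar operations act. -/
def toNonzero (a : fgSubmonoid D K) : NonzeroSubmodule D K := ⟨a.1, a.2.1⟩

theorem toNonzero_isFG (a : fgSubmonoid D K) : (toNonzero a).IsFG := a.2.2

theorem toNonzero_mul (a b : fgSubmonoid D K) :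
    toNonzero (a * b) = toNonzero a * toNonzero b := rfl

/-- The principal submodule `D x`. -/
def principal (D : Type*) {K : Type*} [CommRing D] [Field K] [Algebra D K] (x : K) (hx : x ≠ 0) :
    fgSubmonoid D K :=
  ⟨Submodule.span D {x}, by simpa using hx, Submodule.fg_span_singleton x⟩

theorem principal_mul_inv (x : K) (hx : x ≠ 0) :
    principal D x hx * principal D x⁻¹ (inv_ne_zero hx) = 1 := by
  apply Subtype.ext
  change Submodule.span D {x} * Submodule.span D {x⁻¹} = 1
  rw [Submodule.span_mul_span, Set.singleton_mul_singleton, mul_inv_cancel₀ hx,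
    Submodule.one_eq_span]

end fgSubmonoid

/-! ### The valuation overring of a total preorder -/

namespace IsCancelPreorder

variable {D K : Type*} [CommRing D] [Field K] [Algebra D K]
  {r : fgSubmonoid D K → fgSubmonoid D K → Prop}

/-- `y` lies in a finitely generated submodule that is `r`-below `b`. For `y ≠ 0` this says
`r (D y) b`; it holds for `y = 0`. -/
def MemBelow (r : fgSubmonoid D K → fgSubmonoid D K → Prop) (y : K) (b : fgSubmonoid D K) : Prop :=
  ∃ N : fgSubmonoid D K, y ∈ N.1 ∧ r N b

theorem memBelow_of_mem (hr : IsCancelPreorder r) {y : K} {b : fgSubmonoid D K} (h : y ∈ b.1) :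
    MemBelow r y b := ⟨b, h, hr.of_le le_rfl⟩

theorem MemBelow.trans (hr : IsCancelPreorder r) {y : K} {b c : fgSubmonoid D K}
    (h : MemBelow r y b) (hbc : r b c) : MemBelow r y c := by
  obtain ⟨N, hN, h⟩ := h
  exact ⟨N, hN, hr.trans h hbc⟩

theorem MemBelow.add (hr : IsCancelPreorder r) {y z : K} {b : fgSubmonoid D K}
    (h : MemBelow r y b) (h' : MemBelow r z b) : MemBelow r (y + z) b := by
  obtain ⟨N, hN, h⟩ := h
  obtain ⟨N', hN', h'⟩ := h'
  exact ⟨N ⊔ N', Submodule.add_mem_sup hN hN', hr.sup h h'⟩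

theorem MemBelow.mul (hr : IsCancelPreorder r) {y z : K} {b c : fgSubmonoid D K}
    (h : MemBelow r y b) (h' : MemBelow r z c) : MemBelow r (y * z) (b * c) := by
  obtain ⟨N, hN, h⟩ := h
  obtain ⟨N', hN', h'⟩ := h'
  exact ⟨N * N', Submodule.mul_mem_mul hN hN', hr.mul h h'⟩

theorem MemBelow.principal (hr : IsCancelPreorder r) {y : K} {b : fgSubmonoid D K}
    (h : MemBelow r y b) (hy : y ≠ 0) : r (fgSubmonoid.principal D y hy) b := by
  obtain ⟨N, hN, h⟩ := h
  refine hr.trans (hr.of_le ?_) h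
  change Submodule.span D {y} ≤ N.1
  rwa [Submodule.span_singleton_le_iff_mem]

theorem memBelow_principal (hr : IsCancelPreorder r) {y : K} (hy : y ≠ 0) :
    MemBelow r y (fgSubmonoid.principal D y hy) :=
  hr.memBelow_of_mem (Submodule.mem_span_singleton_self y)

/-- The overring of all `y` with `D y` below `D`. -/
def overring (hr : IsCancelPreorder r) : Subalgebra D K where
  carrier := {y | MemBelow r y 1}
  add_mem' h h' := MemBelow.add hr h h'
  mul_mem' h h' := by simpa using MemBelow.mul hr h h'
  algebraMap_mem' d := hr.memBelow_of_mem (Submodule.algebraMap_mem d)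

theorem mem_overring (hr : IsCancelPreorder r) {y : K} : y ∈ hr.overring ↔ MemBelow r y 1 :=
  Iff.rfl

theorem mem_overring_or_inv_mem (hr : IsCancelPreorder r) (htot : ∀ a b, r a b ∨ r b a) (y : K) :
    y ∈ hr.overring ∨ y⁻¹ ∈ hr.overring := by
  by_cases hy : y = 0
  · exact Or.inl (hy ▸ zero_mem _)
  rcases htot (fgSubmonoid.principal D y hy) 1 with h | h
  · exact Or.inl ((hr.memBelow_principal hy).trans hr h)
  · have h1 := hr.mul_right (fgSubmonoid.principal D y⁻¹ (inv_ne_zero hy)) h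
    rw [fgSubmonoid.principal_mul_inv, one_mul] at h1
    exact Or.inr ((hr.memBelow_principal _).trans hr h1)

/-- For a total preorder, a finitely generated submodule is equivalent to one of its principal
submodules. -/
theorem exists_principal (hr : IsCancelPreorder r) (htot : ∀ a b, r a b ∨ r b a)
    (N : fgSubmonoid D K) :
    ∃ a ∈ N.1, ∃ ha : a ≠ 0, r N (fgSubmonoid.principal D a ha) := by
  have key : ∀ N : Submodule D K, N.FG → ∀ hN : N ∈ fgSubmonoid D K,
      ∃ a ∈ N, ∃ ha : a ≠ 0, r ⟨N, hN⟩ (fgSubmonoid.principal D a ha) := by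
    intro N hfg
    induction N, hfg using Submodule.fg_induction with
    | singleton x =>
      intro hN
      refine ⟨x, Submodule.mem_span_singleton_self x, ?_, hr.of_le le_rfl⟩
      rintro rfl
      exact hN.1 (by simp)
    | sup N₁ N₂ hfg₁ hfg₂ ih₁ ih₂ =>
      intro hN
      by_cases h₁ : N₁ = ⊥
      · subst h₁
        have h : ⊥ ⊔ N₂ = N₂ := bot_sup_eq N₂
        simp only [h] at hN ⊢
        exact ih₂ hN
      by_cases h₂ : N₂ = ⊥
      · subst h₂
        have h : N₁ ⊔ ⊥ = N₁ := sup_bot_eq N₁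
        simp only [h] at hN ⊢
        exact ih₁ hN
      obtain ⟨a, haN, ha, h⟩ := ih₁ ⟨h₁, hfg₁⟩
      obtain ⟨b, hbN, hb, h'⟩ := ih₂ ⟨h₂, hfg₂⟩
      have e : (⟨N₁ ⊔ N₂, hN⟩ : fgSubmonoid D K) = ⟨N₁, h₁, hfg₁⟩ ⊔ ⟨N₂, h₂, hfg₂⟩ := Subtype.ext rfl
      rw [e]
      rcases htot (fgSubmonoid.principal D a ha) (fgSubmonoid.principal D b hb) with hab | hab
      · exact ⟨b, Submodule.mem_sup_right hbN, hb, hr.sup (hr.trans h hab) h'⟩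
      · exact ⟨a, Submodule.mem_sup_left haN, ha, hr.sup h (hr.trans h' hab)⟩
  exact key N.1 N.2.2 N.2

/-- An element below `N` lies in `N V`: if `N` is equivalent to `D a` with `a ∈ N`, then
`y / a ∈ V`. -/
theorem mem_mul_overring (hr : IsCancelPreorder r) (htot : ∀ a b, r a b ∨ r b a)
    {N : fgSubmonoid D K} {y : K} (h : MemBelow r y N) :
    y ∈ N.1 * Subalgebra.toSubmodule hr.overring := by
  obtain ⟨a, haN, ha, hNa⟩ := hr.exists_principal htot N
  have h1 := (h.trans hr hNa).mul hr (hr.memBelow_principal (inv_ne_zero ha))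
  rw [fgSubmonoid.principal_mul_inv] at h1
  have h2 := Submodule.mul_mem_mul haN
    (show y * a⁻¹ ∈ Subalgebra.toSubmodule hr.overring from h1)
  rwa [mul_comm y, mul_inv_cancel_left₀ ha] at h2

end IsCancelPreorder

theorem Subalgebra.valuationRing_of_mem_or_inv_mem {D K : Type*} [CommRing D] [Field K]
    [Algebra D K] (V : Subalgebra D K) (hV : ∀ y : K, y ∈ V ∨ y⁻¹ ∈ V) : ValuationRing V where
  cond' a b := by
    by_cases ha : a = 0
    · exact ⟨0, Or.inr (by simp [ha])⟩
    by_cases hb : b = 0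
    · exact ⟨0, Or.inl (by simp [hb])⟩
    have ha' : (a : K) ≠ 0 := by simpa using ha
    have hb' : (b : K) ≠ 0 := by simpa using hb
    rcases hV ((b : K) / a) with h | h
    · exact ⟨⟨_, h⟩, Or.inl (Subtype.ext (by simp [mul_div_cancel₀, ha']))⟩
    · rw [inv_div] at h
      exact ⟨⟨_, h⟩, Or.inr (Subtype.ext (by simp [mul_div_cancel₀, hb']))⟩

namespace SemistarOperation

variable {D K : Type*} [CommRing D] [Field K] [Algebra D K]

/-! ### The finite type operation associated with a semistar operation -/

theorem le_iff (s : SemistarOperation D K) {E F : NonzeroSubmodule D K} : s E ≤ s F ↔ E ≤ s F := by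
  refine ⟨(s.le_map' E).trans, fun h => ?_⟩
  have h1 := s.mono' _ _ h
  rwa [s.idem'] at h1

theorem finiteTypeMap_of_isFG (s : SemistarOperation D K) {F : NonzeroSubmodule D K}
    (hF : F.IsFG) : s.finiteTypeMap F = s F := by
  apply le_antisymm
  · rintro x ⟨G, -, hGF, hx⟩
    exact s.mono' _ _ hGF hx
  · exact fun x hx => ⟨F, hF, le_rfl, hx⟩

/-- A finitely generated submodule of `⋃ {G^⋆ | G ≤ E}` already lies in a single `G^⋆`, since the
union is directed. -/
theorem exists_le_of_le_finiteTypeMap (s : SemistarOperation D K) {E F : NonzeroSubmodule D K}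
    (hF : F.IsFG) (h : F ≤ s.finiteTypeMap E) :
    ∃ G : NonzeroSubmodule D K, G.IsFG ∧ G ≤ E ∧ F ≤ s G := by
  have key : ∀ N : Submodule D K, N.FG → N ≤ (s.finiteTypeMap E).1 →
      ∃ G : NonzeroSubmodule D K, G.IsFG ∧ G ≤ E ∧ N ≤ (s G).1 := by
    intro N hfg
    induction N, hfg using Submodule.fg_induction with
    | singleton x =>
      intro hx
      obtain ⟨G, hG, hGE, hxG⟩ := (Submodule.span_singleton_le_iff_mem _ _).1 hx
      exact ⟨G, hG, hGE, (Submodule.span_singleton_le_iff_mem _ _).2 hxG⟩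
    | sup N₁ N₂ _ _ ih₁ ih₂ =>
      intro hN
      obtain ⟨G₁, hG₁, hGE₁, h₁⟩ := ih₁ (le_sup_left.trans hN)
      obtain ⟨G₂, hG₂, hGE₂, h₂⟩ := ih₂ (le_sup_right.trans hN)
      exact ⟨G₁.sum G₂, hG₁.sum hG₂, sum_le hGE₁ hGE₂,
        sup_le (h₁.trans (s.mono' _ _ (le_sum_left G₁ G₂)))
          (h₂.trans (s.mono' _ _ (le_sum_right G₁ G₂)))⟩
  exact key F.1 hF h

theorem scale_mono {z : K} (hz : z ≠ 0) {E F : NonzeroSubmodule D K} (h : E ≤ F) :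
    scale z hz E ≤ scale z hz F :=
  Submodule.map_mono (f := LinearMap.mulLeft D z) h

theorem scale_inv_scale {z : K} (hz : z ≠ 0) (E : NonzeroSubmodule D K) :
    scale z hz (scale z⁻¹ (inv_ne_zero hz) E) = E := by
  apply Subtype.ext
  ext x
  constructor
  · rintro ⟨_, ⟨y, hy, rfl⟩, rfl⟩
    simpa [mul_inv_cancel_left₀ hz] using hy
  · exact fun hx => ⟨_, ⟨x, hx, rfl⟩, by simp [mul_inv_cancel_left₀ hz]⟩

theorem scale_finiteTypeMap_le (s : SemistarOperation D K) (z : K) (hz : z ≠ 0)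
    (E : NonzeroSubmodule D K) :
    scale z hz (s.finiteTypeMap E) ≤ s.finiteTypeMap (scale z hz E) := by
  rintro _ ⟨x, ⟨F, hF, hFE, hx⟩, rfl⟩
  refine ⟨scale z hz F, Submodule.FG.map _ hF, scale_mono hz hFE, ?_⟩
  rw [s.map_scale']
  exact ⟨x, hx, rfl⟩

theorem finiteTypeMap_mono (s : SemistarOperation D K) {E F : NonzeroSubmodule D K} (h : E ≤ F) :
    s.finiteTypeMap E ≤ s.finiteTypeMap F :=
  fun _ ⟨G, hG, hGE, hx⟩ => ⟨G, hG, hGE.trans h, hx⟩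

theorem le_finiteTypeMap (s : SemistarOperation D K) (E : NonzeroSubmodule D K) :
    E ≤ s.finiteTypeMap E := by
  intro x hx
  by_cases hx0 : x = 0
  · exact hx0 ▸ zero_mem _
  refine ⟨NonzeroSubmodule.principal D x hx0, principal_isFG x hx0,
    (Submodule.span_singleton_le_iff_mem _ _).2 hx, s.le_map' _ ?_⟩
  exact Submodule.mem_span_singleton_self x

/-- The semistar operation `⋆_f`. -/
def finiteType (s : SemistarOperation D K) : SemistarOperation D K where
  toFun := s.finiteTypeMap
  map_scale' z hz E := by
    refine le_antisymm ?_ (s.scale_finiteTypeMap_le z hz E)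
    have h := scale_mono hz
      (s.scale_finiteTypeMap_le z⁻¹ (inv_ne_zero hz) (scale z hz E))
    rw [scale_inv_scale] at h
    have h2 := scale_inv_scale (inv_ne_zero hz) E
    simp only [inv_inv] at h2
    rwa [h2] at h
  mono' _ _ h := s.finiteTypeMap_mono h
  le_map' := s.le_finiteTypeMap
  idem' E := by
    refine le_antisymm ?_ (s.le_finiteTypeMap _)
    rintro x ⟨F, hF, hFE, hx⟩
    obtain ⟨G, hG, hGE, hFG⟩ := s.exists_le_of_le_finiteTypeMap hF hFE
    exact ⟨G, hG, hGE, s.le_iff.2 hFG hx⟩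

theorem IsEquivalent.finiteTypeMap_eq {s t : SemistarOperation D K} (h : t.IsEquivalent s) :
    t.finiteTypeMap = s.finiteTypeMap := by
  funext E
  apply le_antisymm
  · rintro x ⟨F, hF, hFE, hx⟩
    exact ⟨F, hF, hFE, h F hF ▸ hx⟩
  · rintro x ⟨F, hF, hFE, hx⟩
    exact ⟨F, hF, hFE, (h F hF).symm ▸ hx⟩

theorem IsEquivalent.toFun_eq_finiteTypeMap {s t : SemistarOperation D K}
    (h : t.IsEquivalent s) (ht : t.IsFiniteType) : t.toFun = s.finiteTypeMap :=
  ht.trans h.finiteTypeMap_eq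

theorem finiteType_isEquivalent (s : SemistarOperation D K) : s.finiteType.IsEquivalent s :=
  fun _ hF => s.finiteTypeMap_of_isFG hF

theorem finiteType_isFiniteType (s : SemistarOperation D K) : s.finiteType.IsFiniteType :=
  s.finiteType_isEquivalent.finiteTypeMap_eq.symm

theorem IsEAB.of_isEquivalent {s t : SemistarOperation D K} (hs : s.IsEAB)
    (h : t.IsEquivalent s) : t.IsEAB := by
  intro F hF G H hG hH hle
  rw [h _ (hF.mul hG), h _ (hF.mul hH)] at hle
  rw [h G hG, h H hH]
  exact hs F hF G H hG hH hle

theorem ext_toFun {s t : SemistarOperation D K} (h : s.toFun = t.toFun) : s = t := by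
  cases s
  cases t
  congr

/-! ### The operation defined by colons -/

theorem finiteTypeMap_eq_aMap (s : SemistarOperation D K) (hs : s.IsEAB) :
    s.finiteTypeMap = s.aMap := by
  funext E
  apply le_antisymm
  · rintro x ⟨F, hF, hFE, hx⟩
    refine ⟨F, hF, hFE, NonzeroSubmodule.principal D 1 one_ne_zero, principal_isFG _ _, ?_⟩
    have h1 : F * NonzeroSubmodule.principal D (1 : K) one_ne_zero = F :=
      Subtype.ext (by
        change F.1 * Submodule.span D {1} = F.1
        rw [← Submodule.one_eq_span, mul_one])
    rw [mem_div_iff, h1]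
    intro y hy
    obtain ⟨d, rfl⟩ := Submodule.mem_span_singleton.1 hy
    rw [mul_smul_comm, mul_one]
    exact Submodule.smul_mem _ d hx
  · rintro x ⟨F, hF, hFE, H, hH, hx⟩
    by_cases hx0 : x = 0
    · exact hx0 ▸ zero_mem _
    refine ⟨F, hF, hFE, ?_⟩
    rw [mem_div_iff] at hx
    have h1 : H * NonzeroSubmodule.principal D x hx0 ≤ s (H * F) := by
      refine Submodule.mul_le.2 fun y hy z hz => ?_
      obtain ⟨d, rfl⟩ := Submodule.mem_span_singleton.1 hz
      rw [mul_smul_comm, mul_comm y]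
      have h2 : H * F = F * H := Subtype.ext (mul_comm H.1 F.1)
      rw [h2]
      exact Submodule.smul_mem _ d (hx y hy)
    -- cancel `H` from `x H ⊆ (F H)^⋆`
    have h3 := hs H hH _ F (principal_isFG x hx0) hF (s.le_iff.2 h1)
    exact h3 (s.le_map' _ (Submodule.mem_span_singleton_self x))

/-! ### The operation defined by valuation overrings -/

/-- The preorder on finitely generated submodules induced by an eab semistar operation. -/
theorem IsEAB.isCancelPreorder {s : SemistarOperation D K} (hs : s.IsEAB) :
    IsCancelPreorder fun a b : fgSubmonoid D K => a.1 ≤ (s (fgSubmonoid.toNonzero b)).1 where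
  of_le {a b} h := by
    have h1 : a.1 ≤ b.1 := h
    exact h1.trans (s.le_map' (fgSubmonoid.toNonzero b))
  trans {a b c} h h' := by
    have h1 : fgSubmonoid.toNonzero b ≤ s (fgSubmonoid.toNonzero c) := h'
    exact h.trans (s.le_iff.2 h1)
  sup {a b c} h h' := by
    rw [fgSubmonoid.coe_sup]
    exact sup_le h h'
  mul_right {a b} c h := by
    refine Submodule.mul_le.2 fun y hy z hz => ?_
    by_cases hz0 : z = 0
    · simp [hz0]
    have h1 : scale z hz0 (s (fgSubmonoid.toNonzero b)) ≤ s (fgSubmonoid.toNonzero (b * c)) := by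
      rw [← s.map_scale']
      apply s.mono'
      rintro _ ⟨w, hw, rfl⟩
      rw [LinearMap.mulLeft_apply, mul_comm z]
      exact Submodule.mul_mem_mul hw hz
    have h3 := h1 ⟨y, h hy, rfl⟩
    rwa [LinearMap.mulLeft_apply, mul_comm z] at h3
  cancel {a b} c h := by
    have h0 : fgSubmonoid.toNonzero (a * c) ≤ s (fgSubmonoid.toNonzero (b * c)) := h
    rw [mul_comm a, mul_comm b, fgSubmonoid.toNonzero_mul, fgSubmonoid.toNonzero_mul] at h0
    have h1 := hs _ (fgSubmonoid.toNonzero_isFG c) _ _ (fgSubmonoid.toNonzero_isFG a)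
      (fgSubmonoid.toNonzero_isFG b) (s.le_iff.2 h0)
    have h2 : fgSubmonoid.toNonzero a ≤ s (fgSubmonoid.toNonzero b) := s.le_iff.1 h1
    exact h2

theorem isValuationOverring_overring (s : SemistarOperation D K)
    {r : fgSubmonoid D K → fgSubmonoid D K → Prop} (hr : IsCancelPreorder r)
    (htot : ∀ a b, r a b ∨ r b a)
    (hsr : ∀ a b : fgSubmonoid D K, a.1 ≤ (s (fgSubmonoid.toNonzero b)).1 → r a b) :
    s.IsValuationOverring hr.overring := by
  refine ⟨Subalgebra.valuationRing_of_mem_or_inv_mem _ (hr.mem_overring_or_inv_mem htot), ?_⟩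
  intro F hF y hy
  by_cases hy0 : y = 0
  · exact hy0 ▸ zero_mem _
  let N : fgSubmonoid D K := ⟨F.1, F.2, hF⟩
  have hyN : (fgSubmonoid.principal D y hy0).1 ≤ (s (fgSubmonoid.toNonzero N)).1 :=
    (Submodule.span_singleton_le_iff_mem _ _).2 hy
  exact hr.mem_mul_overring htot (N := N) ((hr.memBelow_principal hy0).trans hr (hsr _ _ hyN))

theorem exists_memBelow_of_mem_mul_overring {r : fgSubmonoid D K → fgSubmonoid D K → Prop}
    (hr : IsCancelPreorder r) {E : NonzeroSubmodule D K} {x : K}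
    (hx : x ∈ E.1 * Subalgebra.toSubmodule hr.overring) :
    ∃ a : fgSubmonoid D K, a.1 ≤ E.1 ∧ IsCancelPreorder.MemBelow r x a := by
  induction hx using Submodule.mul_induction_on' with
  | mem_mul_mem e he v hv =>
    obtain ⟨e', he', hee'⟩ : ∃ a : fgSubmonoid D K, a.1 ≤ E.1 ∧ e ∈ a.1 := by
      by_cases he0 : e = 0
      · obtain ⟨F, hF, hFE⟩ := E.exists_isFG_le
        exact ⟨⟨F.1, F.2, hF⟩, hFE, he0 ▸ zero_mem _⟩
      · exact ⟨fgSubmonoid.principal D e he0, (Submodule.span_singleton_le_iff_mem _ _).2 he,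
          Submodule.mem_span_singleton_self e⟩
    refine ⟨e', he', ?_⟩
    have h := (hr.memBelow_of_mem hee').mul hr (hr.mem_overring.1 hv)
    rwa [mul_one] at h
  | add y _ z _ ihy ihz =>
    obtain ⟨a, ha, hya⟩ := ihy
    obtain ⟨b, hb, hzb⟩ := ihz
    refine ⟨a ⊔ b, ?_, (hya.trans hr (hr.of_le le_sup_left)).add hr
      (hzb.trans hr (hr.of_le le_sup_right))⟩
    rw [fgSubmonoid.coe_sup]
    exact sup_le ha hb

/-- An element outside `E^{⋆_f}` lies outside `E V` for the overring `V` of a total extension of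
`F ⊆ G^⋆` that keeps `D x` from being below any finitely generated submodule of `E`. -/
theorem bMap_le_finiteTypeMap (s : SemistarOperation D K) (hs : s.IsEAB)
    (E : NonzeroSubmodule D K) : s.bMap E ≤ s.finiteTypeMap E := by
  intro x hx
  by_contra hxE
  have hx0 : x ≠ 0 := by
    rintro rfl
    exact hxE (zero_mem _)
  have hdir : ∀ a ∈ {a : fgSubmonoid D K | a.1 ≤ E.1}, ∀ b ∈ {a : fgSubmonoid D K | a.1 ≤ E.1},
      a ⊔ b ∈ {a : fgSubmonoid D K | a.1 ≤ E.1} := by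
    intro a ha b hb
    rw [Set.mem_ofPred_eq, fgSubmonoid.coe_sup]
    exact sup_le ha hb
  have hxs : ∀ a ∈ {a : fgSubmonoid D K | a.1 ≤ E.1},
      ¬ (fgSubmonoid.principal D x hx0).1 ≤ (s (fgSubmonoid.toNonzero a)).1 := fun a ha h =>
    hxE ⟨fgSubmonoid.toNonzero a, fgSubmonoid.toNonzero_isFG a, ha,
      h (Submodule.mem_span_singleton_self x)⟩
  have hd : ∀ a b c : fgSubmonoid D K, (a ⊔ b) * c = a * c ⊔ b * c := fgSubmonoid.sup_mul
  obtain ⟨r, hr, hsr, htot, hxr⟩ := IsCancelPreorder.exists_total_extension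
    hd hs.isCancelPreorder (fgSubmonoid.principal D x hx0) _ hdir hxs
  have hxV : x ∈ E.1 * Subalgebra.toSubmodule hr.overring :=
    (Submodule.mem_iInf _).1 ((Submodule.mem_iInf _).1 hx hr.overring)
      (s.isValuationOverring_overring hr htot hsr)
  obtain ⟨a, ha, hxa⟩ := exists_memBelow_of_mem_mul_overring hr hxV
  exact hxr a ha (hxa.principal hr hx0)

/-! ### The operation defined by the Kronecker function ring -/

/-- `z` is a fraction `f / g` whose numerator has coefficients in `E V` and whose denominator is a
polynomial over `V` that does not vanish modulo the maximal ideal. -/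
def IsPrimitiveFraction (V : Subalgebra D K) [ValuationRing V] (E : Submodule D K)
    (z : RatFunc K) : Prop :=
  ∃ g : V[X], g.map (IsLocalRing.residue V) ≠ 0 ∧
    ∃ f : K[X], (∀ n, f.coeff n ∈ E * Subalgebra.toSubmodule V) ∧
      z * algebraMap K[X] (RatFunc K) (g.map (algebraMap V K)) = algebraMap K[X] (RatFunc K) f

theorem coeff_mul_map_mem {V : Subalgebra D K} {E : Submodule D K} {f : K[X]}
    (hf : ∀ n, f.coeff n ∈ E * Subalgebra.toSubmodule V) (g : V[X]) (n : ℕ) :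
    (f * g.map (algebraMap V K)).coeff n ∈ E * Subalgebra.toSubmodule V := by
  rw [Polynomial.coeff_mul]
  refine Submodule.sum_mem _ fun i _ => ?_
  have hV : Subalgebra.toSubmodule V * Subalgebra.toSubmodule V = Subalgebra.toSubmodule V :=
    V.isIdempotentElem_toSubmodule
  rw [← hV, ← mul_assoc, Polynomial.coeff_map]
  exact Submodule.mul_mem_mul (hf i.1) (g.coeff i.2).2

theorem IsPrimitiveFraction.add {V : Subalgebra D K} [ValuationRing V] {E : Submodule D K}
    {z w : RatFunc K} (hz : IsPrimitiveFraction V E z) (hw : IsPrimitiveFraction V E w) :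
    IsPrimitiveFraction V E (z + w) := by
  obtain ⟨g, hg, f, hf, hzf⟩ := hz
  obtain ⟨g', hg', f', hf', hwf⟩ := hw
  refine ⟨g * g', ?_, f * g'.map (algebraMap V K) + f' * g.map (algebraMap V K), fun n => ?_, ?_⟩
  · rw [Polynomial.map_mul]
    exact mul_ne_zero hg hg'
  · rw [Polynomial.coeff_add]
    exact add_mem (coeff_mul_map_mem hf g' n) (coeff_mul_map_mem hf' g n)
  · rw [Polynomial.map_mul, map_mul, map_add, map_mul, map_mul, ← hzf, ← hwf]
    ring

variable [IsFractionRing D K]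

theorem algebraMap_coeff_mem_content {f : D[X]} (hf : f ≠ 0) (n : ℕ) :
    algebraMap D K (f.coeff n) ∈ (contentSubmodule K f hf).1 :=
  Submodule.subset_span ⟨n, rfl⟩

theorem toRatFunc_ne_zero {g : D[X]} (hg : g ≠ 0) : toRatFunc K g ≠ 0 := by
  rw [toRatFunc, Ne, FaithfulSMul.algebraMap_eq_zero_iff,
    Polynomial.map_eq_zero_iff (IsFractionRing.injective D K)]
  exact hg

/-- Some nonzero coefficient of `g` divides all coefficients of `g` in the valuation ring `V`. -/
theorem exists_coeff_dvd (V : Subalgebra D K) (hV : ∀ y : K, y ∈ V ∨ y⁻¹ ∈ V) {g : D[X]}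
    (hg : g ≠ 0) :
    ∃ m, g.coeff m ≠ 0 ∧
      ∀ n, algebraMap D K (g.coeff n) / algebraMap D K (g.coeff m) ∈ V := by
  let v : ℕ → K := fun n => algebraMap D K (g.coeff n)
  have hv : ∀ {n}, g.coeff n ≠ 0 → v n ≠ 0 := fun h => by
    rwa [Ne, FaithfulSMul.algebraMap_eq_zero_iff]
  have key : ∀ t : Finset ℕ, t.Nonempty → (∀ n ∈ t, g.coeff n ≠ 0) →
      ∃ m ∈ t, ∀ n ∈ t, v n / v m ∈ V := by
    intro t ht
    induction ht using Finset.Nonempty.cons_induction with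
    | singleton i =>
      intro hi
      refine ⟨i, Finset.mem_singleton_self i, fun n hn => ?_⟩
      rw [Finset.mem_singleton.1 hn, div_self (hv (hi i (Finset.mem_singleton_self i)))]
      exact one_mem V
    | cons i t hit ht ih =>
      intro hi
      have hi0 := hv (hi i (Finset.mem_cons_self i t))
      obtain ⟨m, hm, hmV⟩ := ih fun n hn => hi n (Finset.mem_cons_of_mem hn)
      have hm0 := hv (hi m (Finset.mem_cons_of_mem hm))
      rcases hV (v i / v m) with h | h
      · refine ⟨m, Finset.mem_cons_of_mem hm, fun n hn => ?_⟩
        rcases Finset.mem_cons.1 hn with rfl | hn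
        · exact h
        · exact hmV n hn
      · rw [inv_div] at h
        refine ⟨i, Finset.mem_cons_self i t, fun n hn => ?_⟩
        rcases Finset.mem_cons.1 hn with rfl | hn
        · rw [div_self hi0]
          exact one_mem V
        · rw [← div_mul_div_cancel₀ hm0]
          exact mul_mem (hmV n hn) h
  obtain ⟨m, hm, hmV⟩ := key g.support (Polynomial.nonempty_support_iff.2 hg)
    fun n hn => Polynomial.mem_support_iff.1 hn
  refine ⟨m, Polynomial.mem_support_iff.1 hm, fun n => ?_⟩
  by_cases hn : g.coeff n = 0
  · simp [hn]
  · exact hmV n (Polynomial.mem_support_iff.2 hn)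

variable [IsDomain D]

theorem contentSubmodule_one : (contentSubmodule K (1 : D[X]) one_ne_zero).1 = 1 := by
  rw [Submodule.one_eq_span]
  refine le_antisymm (Submodule.span_le.2 ?_) ((Submodule.span_singleton_le_iff_mem _ _).2 ?_)
  · rintro _ ⟨n, rfl⟩
    rw [← Submodule.one_eq_span]
    exact Submodule.algebraMap_mem _
  · simpa using algebraMap_coeff_mem_content (K := K) (one_ne_zero (α := D[X])) 0

theorem div_mem_kroneckerSet (s : SemistarOperation D K) (f g : D[X]) (hg : g ≠ 0)
    (h : ∀ n, algebraMap D K (f.coeff n) ∈ (s (contentSubmodule K g hg)).1) :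
    toRatFunc K f / toRatFunc K g ∈ s.kroneckerSet := by
  refine ⟨f, g, hg, rfl, fun hf => ⟨1, one_ne_zero, ?_⟩⟩
  have e : ∀ E : NonzeroSubmodule D K, E * contentSubmodule K (1 : D[X]) one_ne_zero = E :=
    fun E => Subtype.ext (by rw [coe_mul, contentSubmodule_one, mul_one])
  rw [e, e, s.le_iff]
  refine Submodule.span_le.2 ?_
  rintro _ ⟨n, rfl⟩
  exact h n

/-- If `F` is generated by `a₀, …, aₙ₋₁` and `x ∈ F^⋆`, then `x = ∑ aᵢ * (x Xⁱ / ∑ aⱼ Xʲ)`, where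
after clearing denominators each fraction belongs to the Kronecker function ring. -/
theorem finiteTypeMap_le_krMap (s : SemistarOperation D K) (E : NonzeroSubmodule D K) :
    s.finiteTypeMap E ≤ s.krMap E := by
  rintro x ⟨F, hF, hFE, hx⟩
  obtain ⟨n, a, ha⟩ := Submodule.fg_iff_exists_fin_generating_family.1 hF
  obtain ⟨d, hd⟩ := IsLocalization.exist_integer_multiples_of_finite (nonZeroDivisors D)
    (fun i : Option (Fin n) => i.elim x a)
  obtain ⟨y, hy⟩ := hd none
  choose b hb using fun i => hd (some i)
  simp only [Option.elim, Algebra.smul_def] at hy hb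
  have hd0 : algebraMap D K d ≠ 0 :=
    IsFractionRing.to_map_ne_zero_of_mem_nonZeroDivisors d.2
  let p : D[X] := ∑ i : Fin n, Polynomial.C (b i) * Polynomial.X ^ (i : ℕ)
  have hpc : ∀ i : Fin n, p.coeff i = b i := by
    intro i
    simp [p, Polynomial.finsetSum_coeff, Polynomial.coeff_X_pow, Fin.val_inj]
  have hp : p ≠ 0 := by
    intro hp0
    refine F.2 ?_
    rw [← ha, Submodule.span_eq_bot]
    rintro _ ⟨i, rfl⟩
    have h1 := hb i
    rw [← hpc, hp0, Polynomial.coeff_zero, map_zero] at h1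
    exact (mul_eq_zero.1 h1.symm).resolve_left hd0
  have hFp : scale (algebraMap D K d) hd0 F ≤ contentSubmodule K p hp := by
    rintro _ ⟨z, hz, rfl⟩
    have hz' : z ∈ Submodule.span D (Set.range a) := by rw [ha]; exact hz
    induction hz' using Submodule.span_induction with
    | mem z hza =>
      obtain ⟨i, rfl⟩ := hza
      rw [LinearMap.mulLeft_apply, ← hb, ← hpc]
      exact algebraMap_coeff_mem_content hp i
    | zero => rw [map_zero]; exact zero_mem _
    | add z w hz' hw' ihz ihw =>
      rw [map_add]
      exact add_mem (ihz (by rw [← ha]; exact hz')) (ihw (by rw [← ha]; exact hw'))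
    | smul c z hz' ihz =>
      rw [map_smul]
      exact Submodule.smul_mem _ c (ihz (by rw [← ha]; exact hz'))
  have hyp : algebraMap D K y ∈ (s (contentSubmodule K p hp)).1 := by
    have h1 := s.mono' _ _ hFp
    rw [s.map_scale'] at h1
    exact h1 ⟨x, hx, hy.symm⟩
  have hk : ∀ i : Fin n, toRatFunc K (Polynomial.C y * Polynomial.X ^ (i : ℕ)) / toRatFunc K p ∈
      s.kroneckerSet := by
    intro i
    refine s.div_mem_kroneckerSet _ _ hp fun m => ?_
    rw [Polynomial.coeff_C_mul_X_pow]
    split_ifs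
    · exact hyp
    · rw [map_zero]; exact zero_mem _
  have hsum : algebraMap K (RatFunc K) x = ∑ i : Fin n, algebraMap K (RatFunc K) (a i) *
      (toRatFunc K (Polynomial.C y * Polynomial.X ^ (i : ℕ)) / toRatFunc K p) := by
    simp only [← mul_div_assoc]
    rw [← Finset.sum_div, eq_div_iff (toRatFunc_ne_zero hp)]
    simp only [p, toRatFunc, Polynomial.map_sum, map_sum, Finset.mul_sum]
    refine Finset.sum_congr rfl fun i _ => ?_
    simp only [IsScalarTower.algebraMap_apply K K[X] (RatFunc K), ← map_mul]
    congr 1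
    simp only [Polynomial.map_mul, Polynomial.map_C, Polynomial.algebraMap_eq, ← mul_assoc,
      ← Polynomial.C_mul, hy, hb]
    congr 2
    ring
  change algebraMap K (RatFunc K) x ∈ s.kroneckerExtension E
  rw [hsum]
  refine Submodule.sum_mem _ fun i _ => Submodule.subset_span ⟨a i, hFE ?_, _, hk i, rfl⟩
  rw [← ha]
  exact Submodule.subset_span ⟨i, rfl⟩

/-- A valuation overring of `D` has quotient field `K`, so it is a valuation ring of `K`. -/
theorem mem_or_inv_mem_of_valuationRing (V : Subalgebra D K) (hV : ValuationRing V) (y : K) :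
    y ∈ V ∨ y⁻¹ ∈ V := by
  obtain ⟨a, b, hb, rfl⟩ := IsFractionRing.div_surjective (A := D) y
  by_cases ha : a = 0
  · left
    simp [ha]
  have hb' : algebraMap D K b ≠ 0 := IsFractionRing.to_map_ne_zero_of_mem_nonZeroDivisors hb
  have ha' : algebraMap D K a ≠ 0 := by
    rwa [Ne, FaithfulSMul.algebraMap_eq_zero_iff]
  obtain ⟨c, hc | hc⟩ := ValuationRing.cond (algebraMap D V a) (algebraMap D V b)
  · right
    have h : algebraMap D K a * c = algebraMap D K b := congrArg Subtype.val hc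
    rw [inv_div, ← h, mul_div_cancel_left₀ _ ha']
    exact c.2
  · left
    have h : algebraMap D K b * c = algebraMap D K a := congrArg Subtype.val hc
    rw [← h, mul_div_cancel_left₀ _ hb']
    exact c.2

/-- For `f / g` in the Kronecker function ring, the content of `g` divides that of `f` in every
`⋆`-valuation overring `V`: the content of `h` becomes principal over `V` and can be cancelled. -/
theorem coeff_div_mem_of_le {s : SemistarOperation D K} {V : Subalgebra D K}
    (hV : s.IsValuationOverring V) {f g h : D[X]} (hf : f ≠ 0) (hg : g ≠ 0) (hh : h ≠ 0)
    (hle : s (contentSubmodule K f hf * contentSubmodule K h hh) ≤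
      s (contentSubmodule K g hg * contentSubmodule K h hh))
    {m : ℕ} (hm0 : g.coeff m ≠ 0)
    (hm : ∀ n, algebraMap D K (g.coeff n) / algebraMap D K (g.coeff m) ∈ V) (n : ℕ) :
    algebraMap D K (f.coeff n) / algebraMap D K (g.coeff m) ∈ V := by
  obtain ⟨k, hk0, hk⟩ :=
    exists_coeff_dvd (K := K) V (mem_or_inv_mem_of_valuationRing V hV.1) hh
  set γ := algebraMap D K (g.coeff m) with hγ
  set η := algebraMap D K (h.coeff k) with hη
  have hγ0 : γ ≠ 0 := by rwa [Ne, FaithfulSMul.algebraMap_eq_zero_iff]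
  have hη0 : η ≠ 0 := by rwa [Ne, FaithfulSMul.algebraMap_eq_zero_iff]
  have hfg : ∀ {p : D[X]} (hp : p ≠ 0), (contentSubmodule K p hp).IsFG := by
    intro p hp
    refine Submodule.fg_span (((p.support.finite_toSet.image
      fun n => algebraMap D K (p.coeff n)).insert 0).subset ?_)
    rintro _ ⟨n, rfl⟩
    by_cases hn : p.coeff n = 0
    · exact Or.inl (by simp [hn])
    · exact Or.inr ⟨n, Polynomial.mem_support_iff.2 hn, rfl⟩
  -- the fractional ideal `c V` of `V`
  let I : K → Submodule D K := fun c => (Subalgebra.toSubmodule V).comap (LinearMap.mulLeft D c⁻¹)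
  have hI : ∀ {p : D[X]} (hp : p ≠ 0) (c : K),
      (∀ n, algebraMap D K (p.coeff n) / c ∈ V) → (contentSubmodule K p hp).1 ≤ I c := by
    intro p hp c hc
    refine Submodule.span_le.2 ?_
    rintro _ ⟨n, rfl⟩
    change c⁻¹ * algebraMap D K (p.coeff n) ∈ V
    rw [mul_comm, ← div_eq_mul_inv]
    exact hc n
  have h1 : algebraMap D K (f.coeff n) * η ∈
      (s (contentSubmodule K f hf * contentSubmodule K h hh)).1 :=
    s.le_map' _ (Submodule.mul_mem_mul (algebraMap_coeff_mem_content hf n)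
      (algebraMap_coeff_mem_content hh k))
  have h2 := hV.2 _ ((hfg hg).mul (hfg hh)) (hle h1)
  have h3 : (contentSubmodule K g hg * contentSubmodule K h hh).1 * Subalgebra.toSubmodule V ≤
      I (γ * η) := by
    rw [coe_mul]
    refine Submodule.mul_le.2 fun z hz w hw => ?_
    change (γ * η)⁻¹ * (z * w) ∈ V
    rw [← mul_assoc]
    refine mul_mem ?_ hw
    induction hz using Submodule.mul_induction_on' with
    | mem_mul_mem a ha b hb =>
      have h4 : γ⁻¹ * a ∈ V := hI hg γ hm ha
      have h5 : η⁻¹ * b ∈ V := hI hh η hk hb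
      rw [mul_inv, mul_mul_mul_comm]
      exact mul_mem h4 h5
    | add a _ b _ iha ihb =>
      rw [mul_add]
      exact add_mem iha ihb
  have h6 : (γ * η)⁻¹ * (algebraMap D K (f.coeff n) * η) ∈ V := h3 h2
  convert h6 using 1
  field_simp

/-- In a `⋆`-valuation overring, dividing by a coefficient of minimal value puts every element of
`E Kr(D, ⋆)` into primitive form. -/
theorem isPrimitiveFraction_of_mem_kroneckerExtension {s : SemistarOperation D K}
    {V : Subalgebra D K} [ValuationRing V] (hV : s.IsValuationOverring V)
    {E : NonzeroSubmodule D K} {z : RatFunc K} (hz : z ∈ s.kroneckerExtension E) :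
    IsPrimitiveFraction V E.1 z := by
  induction hz using Submodule.span_induction with
  | zero => exact ⟨1, by simp, 0, fun n => by simp, by simp⟩
  | add z w _ _ ihz ihw => exact ihz.add ihw
  | smul d z _ ih =>
    obtain ⟨g, hg, f, hf, hzf⟩ := ih
    refine ⟨g, hg, d • f, fun n => ?_, ?_⟩
    · rw [Polynomial.coeff_smul]
      exact Submodule.smul_mem _ d (hf n)
    · rw [smul_mul_assoc, hzf]
      exact ((IsScalarTower.toAlgHom D K[X] (RatFunc K)).map_smul_of_tower d f).symm
  | mem z hz =>
    obtain ⟨e, he, _, ⟨f, g, hg, rfl, hfg⟩, rfl⟩ := hz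
    obtain ⟨m, hm0, hm⟩ :=
      exists_coeff_dvd (K := K) V (mem_or_inv_mem_of_valuationRing V hV.1) hg
    set γ := algebraMap D K (g.coeff m) with hγ
    have hγ0 : γ ≠ 0 := by rwa [Ne, FaithfulSMul.algebraMap_eq_zero_iff]
    have hfm : ∀ n, algebraMap D K (f.coeff n) / γ ∈ V := by
      intro n
      by_cases hf : f = 0
      · simp [hf]
      obtain ⟨h, hh, hle⟩ := hfg hf
      exact coeff_div_mem_of_le hV hf hg hh hle hm0 hm n
    -- dividing numerator and denominator by `γ` makes the denominator primitive over `V`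
    obtain ⟨g', hg'⟩ : ∃ g' : V[X],
        g'.map (algebraMap V K) = Polynomial.C γ⁻¹ * g.map (algebraMap D K) := by
      have h1 := (Polynomial.lifts_iff_coeff_lifts (f := algebraMap V K)
        (Polynomial.C γ⁻¹ * g.map (algebraMap D K))).2 fun n => by
          refine ⟨⟨_, hm n⟩, ?_⟩
          rw [Polynomial.coeff_C_mul, Polynomial.coeff_map, mul_comm, ← div_eq_mul_inv]
          rfl
      exact (Polynomial.mem_lifts _).1 h1
    refine ⟨g', fun h0 => ?_, Polynomial.C (e * γ⁻¹) * f.map (algebraMap D K), fun n => ?_, ?_⟩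
    · have h1 : g'.coeff m = 1 := by
        apply Subtype.ext
        have h2 := congrArg (fun q => Polynomial.coeff q m) hg'
        simp only [Polynomial.coeff_map, Polynomial.coeff_C_mul] at h2
        exact h2.trans (inv_mul_cancel₀ hγ0)
      have h3 := congrArg (fun q => Polynomial.coeff q m) h0
      simp [h1] at h3
    · rw [Polynomial.coeff_C_mul, Polynomial.coeff_map, mul_assoc]
      refine Submodule.mul_mem_mul he ?_
      rw [mul_comm, ← div_eq_mul_inv]
      exact hfm n
    · have hgK : algebraMap K[X] (RatFunc K) (g.map (algebraMap D K)) ≠ 0 := toRatFunc_ne_zero hg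
      rw [hg', toRatFunc, toRatFunc, map_mul, map_mul, Polynomial.C_mul, map_mul,
        IsScalarTower.algebraMap_apply K K[X] (RatFunc K), Polynomial.algebraMap_eq]
      field_simp

theorem krMap_le_bMap (s : SemistarOperation D K) (E : NonzeroSubmodule D K) :
    s.krMap E ≤ s.bMap E := by
  intro x hx
  refine (Submodule.mem_iInf _).2 fun V => (Submodule.mem_iInf _).2 fun hV => ?_
  have := hV.1
  obtain ⟨g, hg, f, hf, hxf⟩ := isPrimitiveFraction_of_mem_kroneckerExtension hV
    (show algebraMap K (RatFunc K) x ∈ s.kroneckerExtension E from hx)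
  rw [IsScalarTower.algebraMap_apply K K[X] (RatFunc K), ← map_mul] at hxf
  have hxg := RatFunc.algebraMap_injective K hxf
  -- `x` is the quotient of a coefficient of `f` by a unit coefficient of `g`
  obtain ⟨n, hn⟩ : ∃ n, IsLocalRing.residue V (g.coeff n) ≠ 0 := by
    by_contra! h
    exact hg (Polynomial.ext fun n => by simpa using h n)
  obtain ⟨u, hu⟩ := (IsLocalRing.residue_ne_zero_iff_isUnit _).1 hn
  have h1 : x * (g.coeff n : K) = f.coeff n := by
    rw [← hxg, Polynomial.algebraMap_eq, Polynomial.coeff_C_mul, Polynomial.coeff_map]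
    rfl
  have h2 : (g.coeff n : K) * ((u⁻¹ : Vˣ) : V) = 1 := by
    rw [← hu]
    exact congrArg Subtype.val (Units.mul_inv u)
  have h3 : f.coeff n * ((u⁻¹ : Vˣ) : V) ∈ E.1 * Subalgebra.toSubmodule V := by
    have h4 := Submodule.mul_mem_mul (hf n)
      (show (((u⁻¹ : Vˣ) : V) : K) ∈ Subalgebra.toSubmodule V from ((u⁻¹ : Vˣ) : V).2)
    rwa [mul_assoc, V.isIdempotentElem_toSubmodule.eq] at h4
  rwa [← h1, mul_assoc, h2, mul_one] at h3

/-! ### The four operations agree -/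

theorem IsEAB.maps_eq {s : SemistarOperation D K} (hs : s.IsEAB) :
    s.finiteTypeMap = s.krMap ∧ s.krMap = s.bMap ∧ s.bMap = s.aMap := by
  have h1 : s.finiteTypeMap = s.krMap := funext fun E => le_antisymm (s.finiteTypeMap_le_krMap E)
    ((s.krMap_le_bMap E).trans (s.bMap_le_finiteTypeMap hs E))
  have h2 : s.krMap = s.bMap := funext fun E => le_antisymm (s.krMap_le_bMap E)
    ((s.bMap_le_finiteTypeMap hs E).trans (s.finiteTypeMap_le_krMap E))
  exact ⟨h1, h2, by rw [← h2, ← h1, s.finiteTypeMap_eq_aMap hs]⟩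

end SemistarOperation

theorem mainTheorem1 {D K : Type*} [CommRing D] [IsDomain D] [Field K] [Algebra D K]
    [IsFractionRing D K] (s : SemistarOperation D K) (hs : s.IsEAB) :
    (s.finiteTypeMap = s.krMap ∧ s.krMap = s.bMap ∧ s.bMap = s.aMap) ∧
    (∃! t : SemistarOperation D K, t.IsEAB ∧ t.IsEquivalent s ∧ t.IsFiniteType) ∧
    (∀ t : SemistarOperation D K, t.IsEquivalent s → t.IsFiniteType →
      t.toFun = s.finiteTypeMap ∧ t.toFun = s.krMap ∧ t.toFun = s.bMap ∧ t.toFun = s.aMap) := by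
  obtain ⟨h1, h2, h3⟩ := hs.maps_eq
  refine ⟨⟨h1, h2, h3⟩, ⟨s.finiteType, ⟨hs.of_isEquivalent s.finiteType_isEquivalent,
    s.finiteType_isEquivalent, s.finiteType_isFiniteType⟩, ?_⟩, ?_⟩
  · rintro t ⟨-, ht, htf⟩
    exact SemistarOperation.ext_toFun (ht.toFun_eq_finiteTypeMap htf)
  · intro t ht htf
    have h := ht.toFun_eq_finiteTypeMap htf
    exact ⟨h, h.trans h1, h.trans (h1.trans h2), h.trans (h1.trans (h2.trans h3))⟩
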